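/- Let $n\ge 2$, let $\Omega\subset\mathbb R^n$ be a bounded open set, and let $1<p<q<n$. For $r\ge 1$ put $$W^{1,r}(\Omega)=\{v\in W^{1,1}(\Omega): D_kv\in L^{r}(\Omega),\ k=1,\dots,n\},\qquad W^{1,r}_0(\Omega)=\{v\in W^{1,1}_0(\Omega): D_kv\in L^{r}(\Omega),\ k=1,\dots,n\},$$ where $W^{1,1}_0(\Omega)$ is the closure of $C_c^\infty(\Omega)$ in $W^{1,1}(\Omega)$, and for $t>0$ let $L^t_{weak}(\Omega)$ be the set of measurable $g:\Omega\to\mathbb R$ for which there is $k>0$ with $|\{x\in\Omega:|g(x)|>\tau\}|\le k/\tau^t$ for every $\tau>0$. Let $a_i:\Omega\times\mathbb R^n\to\mathbb R$, $i=1,\dots,n$, be Carathéodory functions (measurable in $x$ for every $z$, continuous in $z$ for almost every $x$), and suppose that there are constants $c_1\in\mathbb R$ and $\tilde\nu>0$ such that, for almost every $x\in\Omega$, all $z,\tilde z\in\mathbb R^n$ and all $i$, $$|a_i(x,z)|\le c_1\Big(h(x)+\sum_{j=1}^n|z_j|^{p}\Big)^{1-1/p},\qquad \tilde\nu\sum_{j=1}^n|z_j-\tilde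 z_j|^{p}\le\sum_{j=1}^n\big(a_j(x,z)-a_j(x,\tilde z)\big)(z_j-\tilde z_j),$$ where $0\le h\in L^{q/p}(\Omega)$. Let $f^i\in L^{q/(p-1)}(\Omega)$ for $i=1,\dots,n$, let $\theta\in W^{1,q}(\Omega)$, and let $\psi:\Omega\to[-\infty,+\infty]$ be any function such that $\theta_*=\max\{\psi,\theta\}$ is finite almost everywhere and $\theta_*\in\theta+W_0^{1,q}(\Omega)$. Let $$\mathcal K^{p}_{\psi,\theta}(\Omega)=\{v\in W^{1,p}(\Omega): v\ge\psi \text{ a.e. in } \Omega,\ v\in\theta+W^{1,p}_0(\Omega)\}.$$ Let $u$ be a solution to the $\mathcal K^{p}_{\psi,\theta}$-obstacle problem, that is, $u\in\mathcal K^{p}_{\psi,\theta}(\Omega)$ and $$\int_\Omega\sum_{i=1}^n a_i(x,Du(x))\,(D_iv(x)-D_iu(x))\,dx\ \ge\ \int_\Omega\sum_{i=1}^n f^i(x)\,(D_iv(x)-D_iu(x))\,dx$$ for every $v\in\mathcal K^{p}_{\psi,\theta}(\Omega)$. Then $$u-\theta_*\in L^t_{weak}(\Omega),\qquad t=\frac{nq}{n-q}.$$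 -/

import Mathlib

open MeasureTheory Filter Topology
open scoped ENNReal ContDiff

noncomputable section

namespace ObstacleProblem

/-- The Euclidean space `ℝⁿ`. -/
abbrev E (n : ℕ) : Type := EuclideanSpace ℝ (Fin n)

/-- The classical partial derivative `∂φ/∂x_i`. -/
def classicalPartial {n : ℕ} (i : Fin n) (φ : E n → ℝ) (x : E n) : ℝ :=
  fderiv ℝ φ x (EuclideanSpace.single i (1 : ℝ))

/-- `φ ∈ C_c^∞(Ω)`. -/
def IsTestFunction {n : ℕ} (Ω : Set (E n)) (φ : E n → ℝ) : Prop :=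
  ContDiff ℝ ∞ φ ∧ HasCompactSupport φ ∧ tsupport φ ⊆ Ω

/-- `g` is an `i`-th weak partial derivative of `v` in the open set `Ω`
(both functions are in `L¹_loc(Ω)`). -/
def IsWeakPartial {n : ℕ} (Ω : Set (E n)) (i : Fin n) (v g : E n → ℝ) : Prop :=
  LocallyIntegrableOn v Ω ∧ LocallyIntegrableOn g Ω ∧
    ∀ φ : E n → ℝ, IsTestFunction Ω φ →
      ∫ x in Ω, v x * classicalPartial i φ x = -∫ x in Ω, g x * φ x

open Classical in
/-- A representative of the weak partial derivative `D_i v` in `Ω`; it is unique almost everywhere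
in `Ω` when it exists (the value is the zero function when it does not, but below `D_i v` is only
used for functions in `W^{1,1}(Ω)`). -/
def weakPartial {n : ℕ} (Ω : Set (E n)) (i : Fin n) (v : E n → ℝ) : E n → ℝ :=
  if hv : ∃ g, IsWeakPartial Ω i v g then Classical.choose hv else 0

/-- The weak gradient `Dv = (D_1 v, …, D_n v)`. -/
def weakGradient {n : ℕ} (Ω : Set (E n)) (v : E n → ℝ) (x : E n) : E n :=
  WithLp.toLp 2 (fun i => weakPartial Ω i v x)

/-- `v ∈ W^{1,1}(Ω)`. -/
def MemSobolevOneOne {n : ℕ} (Ω : Set (E n)) (v : E n → ℝ) : Prop :=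
  MemLp v 1 (volume.restrict Ω) ∧
    ∀ i : Fin n, (∃ g, IsWeakPartial Ω i v g) ∧ MemLp (weakPartial Ω i v) 1 (volume.restrict Ω)

/-- `v ∈ W_0^{1,1}(Ω)`, the closure of `C_c^∞(Ω)` in `W^{1,1}(Ω)`. -/
def MemSobolevZeroOneOne {n : ℕ} (Ω : Set (E n)) (v : E n → ℝ) : Prop :=
  MemSobolevOneOne Ω v ∧
    ∃ φ : ℕ → E n → ℝ, (∀ m, IsTestFunction Ω (φ m)) ∧
      Tendsto (fun m => eLpNorm (fun x => φ m x - v x) 1 (volume.restrict Ω)) atTop (𝓝 0) ∧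
      ∀ i : Fin n, Tendsto
        (fun m => eLpNorm (fun x => classicalPartial i (φ m) x - weakPartial Ω i v x) 1
          (volume.restrict Ω)) atTop (𝓝 0)

/-- `v ∈ W^{1,p}(Ω) = {v ∈ W^{1,1}(Ω) : D_k v ∈ L^p(Ω) for every k}`. -/
def MemSobolev {n : ℕ} (Ω : Set (E n)) (p : ℝ) (v : E n → ℝ) : Prop :=
  MemSobolevOneOne Ω v ∧
    ∀ k : Fin n, MemLp (weakPartial Ω k v) (ENNReal.ofReal p) (volume.restrict Ω)

/-- `v ∈ W_0^{1,p}(Ω) = {v ∈ W_0^{1,1}(Ω) : D_k v ∈ L^p(Ω) for every k}`. -/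
def MemSobolevZero {n : ℕ} (Ω : Set (E n)) (p : ℝ) (v : E n → ℝ) : Prop :=
  MemSobolevZeroOneOne Ω v ∧
    ∀ k : Fin n, MemLp (weakPartial Ω k v) (ENNReal.ofReal p) (volume.restrict Ω)

/-- `f ∈ L^t_weak(Ω)` (Marcinkiewicz space). -/
def MemWeakLp {n : ℕ} (Ω : Set (E n)) (t : ℝ) (f : E n → ℝ) : Prop :=
  AEStronglyMeasurable f (volume.restrict Ω) ∧
    ∃ k : ℝ, 0 < k ∧ ∀ τ : ℝ, 0 < τ →
      volume {x ∈ Ω | τ < |f x|} ≤ ENNReal.ofReal (k / τ ^ t)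

/-- `b : Ω × ℝⁿ → ℝ` is a Carathéodory function: (Lebesgue) measurable in `x` for every `z`,
continuous in `z` for almost every `x`. -/
def IsCaratheodory {n : ℕ} (Ω : Set (E n)) (b : E n → E n → ℝ) : Prop :=
  (∀ z, AEStronglyMeasurable (fun x => b x z) (volume.restrict Ω)) ∧
    ∀ᵐ x ∂(volume.restrict Ω), Continuous (b x)

/-- `v ∈ K_{ψ,θ}^p(Ω)`. -/
def MemObstacleClass {n : ℕ} (Ω : Set (E n)) (p : ℝ) (ψ : E n → EReal) (θ v : E n → ℝ) : Prop :=
  MemSobolev Ω p v ∧ (∀ᵐ x ∂(volume.restrict Ω), ψ x ≤ (v x : EReal)) ∧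
    MemSobolevZero Ω p (fun x => v x - θ x)

/-- `u` is a solution to the `K_{ψ,θ}^p`-obstacle problem for
`∑ D_i (a_i(x, Du)) = ∑ D_i f^i` in `Ω`. -/
def IsObstacleSolution {n : ℕ} (Ω : Set (E n)) (p : ℝ) (a : Fin n → E n → E n → ℝ)
    (f : Fin n → E n → ℝ) (ψ : E n → EReal) (θ u : E n → ℝ) : Prop :=
  MemObstacleClass Ω p ψ θ u ∧
    ∀ v : E n → ℝ, MemObstacleClass Ω p ψ θ v →
      ∫ x in Ω, ∑ i, f i x * (weakPartial Ω i v x - weakPartial Ω i u x) ≤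
        ∫ x in Ω, ∑ i, a i x (weakGradient Ω u x) * (weakPartial Ω i v x - weakPartial Ω i u x)

end ObstacleProblem

end

/-! Put w = u - θ_*, A = a(x, Dθ_*) and α = n/(n-1). The proof is a Stampacchia argument on the
level sets of |w|, with smooth tails in place of the usual truncations. Let G be smooth and
monotone, with G' = 0 on [-k, k], G(s) = s for |s| ≥ 2k, and G' ≤ L where L does not depend on k.
Then v = u - G(w) lies between u and θ_*, so it respects the obstacle and is an admissible
competitor.

Testing with v and using monotonicity between Du and Dθ_* bounds the integral of G'(w)|Dw|^p by that
of G'(w)(f - A)·Dw. Young's inequality absorbs half of the left side and leaves G'(w)H, where H = ∑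
|f^i - A_i|^(p/(p-1)) lies in L^(q/p) (`integral_weighted_rpow_le`). Since G'(w) is supported in
{|w| > k}, Hölder bounds the L^1 norm of D(G(w)) by a constant times |{|w| > k}|^(1-1/q)
(`eLpNorm_weighted_le`). The Sobolev inequality from W_0^{1,1} to L^α (`exists_sobolev_const`) and
Chebyshev then give k^α |{|w| > 2k}| ≤ C |{|w| > k}|^β, with β = (1 - 1/q)α. Because q < n, β < 1,
and iterating over dyadic levels (`exists_rpow_decay_of_doubling`) yields decay of order α/(1-β) =
nq/(n-q). -/

namespace ObstacleProblem

/-! ### Test functions and their classical derivatives. -/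

section TestFunctions

variable {n : ℕ} {Ω : Set (E n)} {φ ψ : E n → ℝ}

theorem IsTestFunction.differentiable (hφ : IsTestFunction Ω φ) : Differentiable ℝ φ :=
  hφ.1.differentiable (by simp)

theorem IsTestFunction.sub (hφ : IsTestFunction Ω φ) (hψ : IsTestFunction Ω ψ) :
    IsTestFunction Ω (fun x => φ x - ψ x) :=
  ⟨hφ.1.sub hψ.1, hφ.2.1.sub hψ.2.1,
    (tsupport_sub φ ψ).trans (Set.union_subset hφ.2.2 hψ.2.2)⟩

theorem IsTestFunction.comp {G : ℝ → ℝ} (hG : ContDiff ℝ ∞ G) (hG0 : G 0 = 0)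
    (hφ : IsTestFunction Ω φ) : IsTestFunction Ω (fun x => G (φ x)) :=
  ⟨hG.comp hφ.1, hφ.2.1.comp_left hG0,
    (closure_mono (Function.support_comp_subset hG0 φ)).trans hφ.2.2⟩

theorem IsTestFunction.continuous_classicalPartial (hφ : IsTestFunction Ω φ) (i : Fin n) :
    Continuous (classicalPartial i φ) :=
  (hφ.1.continuous_fderiv (by simp)).clm_apply continuous_const

theorem IsTestFunction.hasCompactSupport_classicalPartial (hφ : IsTestFunction Ω φ) (i : Fin n) :
    HasCompactSupport (classicalPartial i φ) :=
  hφ.2.1.fderiv_apply ℝ _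

theorem IsTestFunction.integrable (hφ : IsTestFunction Ω φ) : Integrable φ :=
  hφ.1.continuous.integrable_of_hasCompactSupport hφ.2.1

theorem IsTestFunction.integrable_classicalPartial (hφ : IsTestFunction Ω φ) (i : Fin n) :
    Integrable (classicalPartial i φ) :=
  (hφ.continuous_classicalPartial i).integrable_of_hasCompactSupport
    (hφ.hasCompactSupport_classicalPartial i)

theorem classicalPartial_sub (hφ : IsTestFunction Ω φ) (hψ : IsTestFunction Ω ψ) (i : Fin n)
    (x : E n) : classicalPartial i (fun x => φ x - ψ x) x
      = classicalPartial i φ x - classicalPartial i ψ x := by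
  unfold classicalPartial
  rw [fderiv_fun_sub (hφ.differentiable x) (hψ.differentiable x)]
  rfl

theorem classicalPartial_comp {G : ℝ → ℝ} (hG : ContDiff ℝ ∞ G) (hφ : IsTestFunction Ω φ)
    (i : Fin n) (x : E n) :
    classicalPartial i (fun x => G (φ x)) x = deriv G (φ x) * classicalPartial i φ x := by
  unfold classicalPartial
  have h1 : HasDerivAt G (deriv G (φ x)) (φ x) :=
    (hG.differentiable (by simp) (φ x)).hasDerivAt
  have h2 := h1.comp_hasFDerivAt x (hφ.differentiable x).hasFDerivAt
  have h3 : fderiv ℝ (fun x => G (φ x)) x = deriv G (φ x) • fderiv ℝ φ x := h2.fderiv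
  rw [h3]
  rfl

theorem IsTestFunction.eq_zero_of_notMem (hφ : IsTestFunction Ω φ) {x : E n} (hx : x ∉ Ω) :
    φ x = 0 :=
  image_eq_zero_of_notMem_tsupport fun h => hx (hφ.2.2 h)

theorem IsTestFunction.fderiv_eq_zero_of_notMem (hφ : IsTestFunction Ω φ) {x : E n}
    (hx : x ∉ Ω) : fderiv ℝ φ x = 0 :=
  image_eq_zero_of_notMem_tsupport fun h => hx (hφ.2.2 (tsupport_fderiv_subset ℝ h))

theorem IsTestFunction.setIntegral_mul_classicalPartial (hφ : IsTestFunction Ω φ)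
    (hψ : IsTestFunction Ω ψ) (i : Fin n) :
    ∫ x in Ω, φ x * classicalPartial i ψ x = -∫ x in Ω, classicalPartial i φ x * ψ x := by
  rw [setIntegral_eq_integral_of_forall_compl_eq_zero, setIntegral_eq_integral_of_forall_compl_eq_zero]
  · refine integral_mul_fderiv_eq_neg_fderiv_mul_of_integrable ?_ ?_ ?_
      (fun x _ => hφ.differentiable x) (fun x _ => hψ.differentiable x)
    · exact ((hφ.continuous_classicalPartial i).mul hψ.1.continuous).integrable_of_hasCompactSupport
        hψ.2.1.mul_left
    · exact (hφ.1.continuous.mul (hψ.continuous_classicalPartial i)).integrable_of_hasCompactSupport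
        hφ.2.1.mul_right
    · exact (hφ.1.continuous.mul hψ.1.continuous).integrable_of_hasCompactSupport hφ.2.1.mul_right
  · intro x hx
    simp [hψ.eq_zero_of_notMem hx]
  · intro x hx
    simp [hφ.eq_zero_of_notMem hx]

end TestFunctions

/-! ### Weak partial derivatives: uniqueness and differences. -/

section WeakPartials

variable {n : ℕ} {Ω : Set (E n)}

/-- The fundamental lemma of the calculus of variations. It lets the arbitrary choice in
`weakPartial` be compared with any gradient computed by hand. -/
theorem IsWeakPartial.ae_eq (hΩ : IsOpen Ω) {i : Fin n} {v g g' : E n → ℝ}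
    (h : IsWeakPartial Ω i v g) (h' : IsWeakPartial Ω i v g') :
    g =ᵐ[volume.restrict Ω] g' := by
  have hloc := h.2.1.sub h'.2.1
  have := hΩ.ae_eq_zero_of_integral_contDiff_smul_eq_zero (μ := volume) hloc ?_
  · rw [EventuallyEq, ae_restrict_iff' hΩ.measurableSet]
    filter_upwards [this] with x hx hxΩ
    simpa [sub_eq_zero] using hx hxΩ
  intro φ h1 h2 h3
  have hφ : IsTestFunction Ω φ := ⟨h1, h2, h3⟩
  have e := (h.2.2 φ hφ).symm.trans (h'.2.2 φ hφ)
  -- Local integrability suffices because the product lives on the compact support of `φ`.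
  have key : ∀ {k : E n → ℝ}, LocallyIntegrableOn k Ω → IntegrableOn (fun x => k x * φ x) Ω := by
    intro k hk
    have hK : IntegrableOn k (tsupport φ) := hk.integrableOn_compact_subset h3 h2
    have : IntegrableOn (fun x => k x * φ x) (tsupport φ) :=
      hK.mul_continuousOn h1.continuous.continuousOn h2
    have h4 : Integrable (fun x => k x * φ x) := by
      rw [← integrableOn_iff_integrable_of_support_subset (s := tsupport φ)]
      · exact this
      · exact (Function.support_mul_subset_right k φ).trans (subset_tsupport φ)
    exact h4.integrableOn
  have hz : ∫ x in Ω, φ x • (g - g') x = 0 := by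
    have : (fun x => φ x • (g - g') x) = fun x => g x * φ x - g' x * φ x := by
      funext x; simp; ring
    rw [this, integral_sub (key h.2.1) (key h'.2.1)]
    linarith
  rw [← hz, setIntegral_eq_integral_of_forall_compl_eq_zero]
  intro x hx
  simp [hφ.eq_zero_of_notMem hx]

theorem isWeakPartial_weakPartial {i : Fin n} {v : E n → ℝ} (h : ∃ g, IsWeakPartial Ω i v g) :
    IsWeakPartial Ω i v (weakPartial Ω i v) := by
  unfold weakPartial
  rw [dif_pos h]
  exact Classical.choose_spec h

theorem IsWeakPartial.weakPartial_ae_eq (hΩ : IsOpen Ω) {i : Fin n} {v g : E n → ℝ}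
    (h : IsWeakPartial Ω i v g) : weakPartial Ω i v =ᵐ[volume.restrict Ω] g :=
  (isWeakPartial_weakPartial ⟨g, h⟩).ae_eq hΩ h

theorem integrable_mul_continuous_of_hasCompactSupport {v b : E n → ℝ} (hv : IntegrableOn v Ω)
    (hb : Continuous b) (hbc : HasCompactSupport b) : IntegrableOn (fun x => v x * b x) Ω := by
  obtain ⟨C, hC⟩ := hb.bounded_above_of_compact_support hbc
  exact hv.mul_bdd (c := C) hb.aestronglyMeasurable (Eventually.of_forall hC)

theorem isWeakPartial_sub {i : Fin n} {v v' g g' : E n → ℝ} (hv : IntegrableOn v Ω)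
    (hv' : IntegrableOn v' Ω) (hg : IntegrableOn g Ω) (hg' : IntegrableOn g' Ω)
    (h : IsWeakPartial Ω i v g) (h' : IsWeakPartial Ω i v' g') :
    IsWeakPartial Ω i (fun x => v x - v' x) (fun x => g x - g' x) := by
  refine ⟨h.1.sub h'.1, h.2.1.sub h'.2.1, fun φ hφ => ?_⟩
  have h1 := h.2.2 φ hφ
  have h2 := h'.2.2 φ hφ
  simp only [sub_mul]
  rw [integral_sub, integral_sub, h1, h2]
  · ring
  · exact integrable_mul_continuous_of_hasCompactSupport hg hφ.1.continuous hφ.2.1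
  · exact integrable_mul_continuous_of_hasCompactSupport hg' hφ.1.continuous hφ.2.1
  · exact integrable_mul_continuous_of_hasCompactSupport hv (hφ.continuous_classicalPartial i)
      (hφ.hasCompactSupport_classicalPartial i)
  · exact integrable_mul_continuous_of_hasCompactSupport hv' (hφ.continuous_classicalPartial i)
      (hφ.hasCompactSupport_classicalPartial i)

theorem MemSobolevOneOne.integrableOn {v : E n → ℝ} (h : MemSobolevOneOne Ω v) :
    IntegrableOn v Ω := memLp_one_iff_integrable.1 h.1

theorem MemSobolevOneOne.integrableOn_weakPartial {v : E n → ℝ} (h : MemSobolevOneOne Ω v)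
    (i : Fin n) : IntegrableOn (weakPartial Ω i v) Ω := memLp_one_iff_integrable.1 (h.2 i).2

theorem MemSobolevOneOne.isWeakPartial {v : E n → ℝ} (h : MemSobolevOneOne Ω v)
    (i : Fin n) : IsWeakPartial Ω i v (weakPartial Ω i v) := isWeakPartial_weakPartial (h.2 i).1

theorem memSobolevOneOne_of_isWeakPartial (hΩ : IsOpen Ω) {v : E n → ℝ} {g : Fin n → E n → ℝ}
    (hv : IntegrableOn v Ω) (hg : ∀ i, IntegrableOn (g i) Ω)
    (h : ∀ i, IsWeakPartial Ω i v (g i)) : MemSobolevOneOne Ω v :=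
  ⟨memLp_one_iff_integrable.2 hv, fun i => ⟨⟨_, h i⟩,
    (memLp_one_iff_integrable.2 (hg i)).ae_eq ((h i).weakPartial_ae_eq hΩ).symm⟩⟩

theorem MemSobolevOneOne.isWeakPartial_sub {v v' : E n → ℝ} (h : MemSobolevOneOne Ω v)
    (h' : MemSobolevOneOne Ω v') (i : Fin n) : IsWeakPartial Ω i (fun x => v x - v' x)
      (fun x => weakPartial Ω i v x - weakPartial Ω i v' x) :=
  ObstacleProblem.isWeakPartial_sub h.integrableOn h'.integrableOn (h.integrableOn_weakPartial i)
    (h'.integrableOn_weakPartial i) (h.isWeakPartial i) (h'.isWeakPartial i)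

theorem MemSobolevOneOne.sub (hΩ : IsOpen Ω) {v v' : E n → ℝ} (h : MemSobolevOneOne Ω v)
    (h' : MemSobolevOneOne Ω v') : MemSobolevOneOne Ω (fun x => v x - v' x) :=
  memSobolevOneOne_of_isWeakPartial hΩ (h.integrableOn.sub h'.integrableOn)
    (fun i => (h.integrableOn_weakPartial i).sub (h'.integrableOn_weakPartial i))
    (h.isWeakPartial_sub h')

theorem MemSobolev.sub (hΩ : IsOpen Ω) {p : ℝ} {v v' : E n → ℝ} (h : MemSobolev Ω p v)
    (h' : MemSobolev Ω p v') : MemSobolev Ω p (fun x => v x - v' x) :=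
  ⟨h.1.sub hΩ h'.1, fun i => ((h.2 i).sub (h'.2 i)).ae_eq
    ((h.1.isWeakPartial_sub h'.1 i).weakPartial_ae_eq hΩ).symm⟩

end WeakPartials

/-! ### Functions of zero trace with an explicit gradient; the chain rule. -/

section ZeroTrace

variable {n : ℕ} {Ω : Set (E n)}

/-- `v` lies in `W_0^{1,1}(Ω)` and its weak gradient has the components `g i`. -/
structure IsSobolevZeroPair (Ω : Set (E n)) (v : E n → ℝ) (g : Fin n → E n → ℝ) : Prop where
  integrableOn : IntegrableOn v Ω
  integrableOn_grad : ∀ i, IntegrableOn (g i) Ω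
  exists_approx : ∃ φ : ℕ → E n → ℝ, (∀ m, IsTestFunction Ω (φ m)) ∧
    Tendsto (fun m => eLpNorm (fun x => φ m x - v x) 1 (volume.restrict Ω)) atTop (𝓝 0) ∧
    ∀ i : Fin n, Tendsto
      (fun m => eLpNorm (fun x => classicalPartial i (φ m) x - g i x) 1
        (volume.restrict Ω)) atTop (𝓝 0)

theorem MemSobolevZeroOneOne.isSobolevZeroPair {v : E n → ℝ} (h : MemSobolevZeroOneOne Ω v) :
    IsSobolevZeroPair Ω v (fun i => weakPartial Ω i v) :=
  ⟨h.1.integrableOn, h.1.integrableOn_weakPartial, h.2⟩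

theorem tendsto_integral_mul_of_eLpNorm {μ : Measure (E n)} {F : ℕ → E n → ℝ} {v b : E n → ℝ}
    {C : ℝ} (hF : ∀ m, Integrable (F m) μ) (hv : Integrable v μ)
    (hb : AEStronglyMeasurable b μ) (hC : ∀ x, ‖b x‖ ≤ C)
    (h : Tendsto (fun m => eLpNorm (fun x => F m x - v x) 1 μ) atTop (𝓝 0)) :
    Tendsto (fun m => ∫ x, F m x * b x ∂μ) atTop (𝓝 (∫ x, v x * b x ∂μ)) := by
  refine tendsto_integral_of_L1' (fun x => v x * b x) (hv.1.mul hb)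
    (Eventually.of_forall fun m => (hF m).mul_bdd (c := C) hb (Eventually.of_forall hC)) ?_
  have h2 : Tendsto (fun m => ENNReal.ofReal C * eLpNorm (fun x => F m x - v x) 1 μ) atTop (𝓝 0) := by
    simpa using ENNReal.Tendsto.const_mul h (Or.inr ENNReal.ofReal_ne_top)
  refine tendsto_of_tendsto_of_tendsto_of_le_of_le tendsto_const_nhds h2 (fun _ => zero_le) ?_
  intro m
  refine eLpNorm_le_mul_eLpNorm_of_ae_le_mul (Eventually.of_forall fun x => ?_) 1
  simp only [Pi.sub_apply]
  rw [← sub_mul, norm_mul, mul_comm]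
  exact mul_le_mul_of_nonneg_right (hC x) (norm_nonneg _)

/-- Integration by parts holds for the approximating test functions, and both sides survive L^1
limits when paired with bounded functions. -/
theorem IsSobolevZeroPair.isWeakPartial {v : E n → ℝ} {g : Fin n → E n → ℝ}
    (h : IsSobolevZeroPair Ω v g) (i : Fin n) : IsWeakPartial Ω i v (g i) := by
  obtain ⟨φ, hφ, h1, h2⟩ := h.exists_approx
  refine ⟨h.integrableOn.locallyIntegrableOn, (h.integrableOn_grad i).locallyIntegrableOn,
    fun ψ hψ => ?_⟩
  obtain ⟨C, hC⟩ := hψ.1.continuous.bounded_above_of_compact_support hψ.2.1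
  obtain ⟨C', hC'⟩ := (hψ.continuous_classicalPartial i).bounded_above_of_compact_support
    (hψ.hasCompactSupport_classicalPartial i)
  have t1 := tendsto_integral_mul_of_eLpNorm (fun m => (hφ m).integrable.integrableOn)
    h.integrableOn (hψ.continuous_classicalPartial i).aestronglyMeasurable hC' h1
  have t2 := tendsto_integral_mul_of_eLpNorm
    (fun m => ((hφ m).integrable_classicalPartial i).integrableOn)
    (h.integrableOn_grad i) hψ.1.continuous.aestronglyMeasurable hC (h2 i)
  refine tendsto_nhds_unique t1 ?_
  simpa only [(hφ _).setIntegral_mul_classicalPartial hψ i] using t2.neg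

theorem IsSobolevZeroPair.weakPartial_ae_eq (hΩ : IsOpen Ω) {v : E n → ℝ} {g : Fin n → E n → ℝ}
    (h : IsSobolevZeroPair Ω v g) (i : Fin n) :
    weakPartial Ω i v =ᵐ[volume.restrict Ω] g i :=
  (h.isWeakPartial i).weakPartial_ae_eq hΩ

theorem IsSobolevZeroPair.memSobolevZeroOneOne (hΩ : IsOpen Ω) {v : E n → ℝ}
    {g : Fin n → E n → ℝ} (h : IsSobolevZeroPair Ω v g) : MemSobolevZeroOneOne Ω v := by
  refine ⟨memSobolevOneOne_of_isWeakPartial hΩ h.integrableOn h.integrableOn_grad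
    h.isWeakPartial, ?_⟩
  obtain ⟨φ, hφ, h1, h2⟩ := h.exists_approx
  refine ⟨φ, hφ, h1, fun i => ?_⟩
  refine (h2 i).congr fun m => eLpNorm_congr_ae ?_
  filter_upwards [h.weakPartial_ae_eq hΩ i] with x hx
  rw [hx]

theorem IsSobolevZeroPair.memSobolevZero (hΩ : IsOpen Ω) {p : ℝ} {v : E n → ℝ}
    {g : Fin n → E n → ℝ} (h : IsSobolevZeroPair Ω v g)
    (hg : ∀ i, MemLp (g i) (ENNReal.ofReal p) (volume.restrict Ω)) : MemSobolevZero Ω p v :=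
  ⟨h.memSobolevZeroOneOne hΩ, fun i => (hg i).ae_eq (h.weakPartial_ae_eq hΩ i).symm⟩

theorem tendsto_eLpNorm_sub_sub {μ : Measure (E n)} {F F' : ℕ → E n → ℝ} {v v' : E n → ℝ}
    (hF : ∀ m, Integrable (F m) μ) (hF' : ∀ m, Integrable (F' m) μ)
    (hv : Integrable v μ) (hv' : Integrable v' μ)
    (h : Tendsto (fun m => eLpNorm (fun x => F m x - v x) 1 μ) atTop (𝓝 0))
    (h' : Tendsto (fun m => eLpNorm (fun x => F' m x - v' x) 1 μ) atTop (𝓝 0)) :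
    Tendsto (fun m => eLpNorm (fun x => F m x - F' m x - (v x - v' x)) 1 μ) atTop (𝓝 0) := by
  have h2 := h.add h'
  rw [add_zero] at h2
  refine tendsto_of_tendsto_of_tendsto_of_le_of_le tendsto_const_nhds h2 (fun _ => zero_le) ?_
  intro m
  have e : (fun x => F m x - F' m x - (v x - v' x))
      = (fun x => F m x - v x) - (fun x => F' m x - v' x) := by
    funext x; simp only [Pi.sub_apply]; ring
  simp only [e]
  exact eLpNorm_sub_le ((hF m).1.sub hv.1) ((hF' m).1.sub hv'.1) le_rfl

theorem IsSobolevZeroPair.sub {v v' : E n → ℝ} {g g' : Fin n → E n → ℝ}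
    (h : IsSobolevZeroPair Ω v g) (h' : IsSobolevZeroPair Ω v' g') :
    IsSobolevZeroPair Ω (fun x => v x - v' x) (fun i x => g i x - g' i x) := by
  obtain ⟨φ, hφ, h1, h2⟩ := h.exists_approx
  obtain ⟨φ', hφ', h1', h2'⟩ := h'.exists_approx
  refine ⟨h.integrableOn.sub h'.integrableOn,
    fun i => (h.integrableOn_grad i).sub (h'.integrableOn_grad i),
    fun m x => φ m x - φ' m x, fun m => (hφ m).sub (hφ' m), ?_, fun i => ?_⟩
  · exact tendsto_eLpNorm_sub_sub (fun m => (hφ m).integrable.integrableOn)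
      (fun m => (hφ' m).integrable.integrableOn) h.integrableOn h'.integrableOn h1 h1'
  · simp only [classicalPartial_sub (hφ _) (hφ' _)]
    exact tendsto_eLpNorm_sub_sub
      (fun m => ((hφ m).integrable_classicalPartial i).integrableOn)
      (fun m => ((hφ' m).integrable_classicalPartial i).integrableOn)
      (h.integrableOn_grad i) (h'.integrableOn_grad i) (h2 i) (h2' i)

/-- Pointwise convergence along a subsequence feeds dominated convergence in the chain rule and
Fatou in the Sobolev inequality. -/
theorem IsSobolevZeroPair.exists_approx_ae {v : E n → ℝ} {g : Fin n → E n → ℝ}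
    (h : IsSobolevZeroPair Ω v g) : ∃ φ : ℕ → E n → ℝ, (∀ m, IsTestFunction Ω (φ m)) ∧
    (∀ᵐ x ∂(volume.restrict Ω), Tendsto (fun m => φ m x) atTop (𝓝 (v x))) ∧
    Tendsto (fun m => eLpNorm (fun x => φ m x - v x) 1 (volume.restrict Ω)) atTop (𝓝 0) ∧
    ∀ i : Fin n, Tendsto
      (fun m => eLpNorm (fun x => classicalPartial i (φ m) x - g i x) 1
        (volume.restrict Ω)) atTop (𝓝 0) := by
  obtain ⟨φ, hφ, h1, h2⟩ := h.exists_approx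
  obtain ⟨ns, hns, hae⟩ := (tendstoInMeasure_of_tendsto_eLpNorm one_ne_zero
    (fun m => (hφ m).1.continuous.aestronglyMeasurable) h.integrableOn.1 h1).exists_seq_tendsto_ae
  exact ⟨fun m => φ (ns m), fun m => hφ _, hae, h1.comp hns.tendsto_atTop,
    fun i => (h2 i).comp hns.tendsto_atTop⟩

/-- Composing the approximants with `G` gives test functions again, as G(0) = 0. The gradient error
splits into G'(φ_m)(∂φ_m - g), bounded through `L`, and (G'(φ_m) - G'(v))g, which tends to zero by
dominated convergence with majorant 2L|g|. The second part needs G' continuous, hence smooth tails.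
-/
theorem IsSobolevZeroPair.comp {v : E n → ℝ} {g : Fin n → E n → ℝ}
    (h : IsSobolevZeroPair Ω v g) {G : ℝ → ℝ} (hG : ContDiff ℝ ∞ G) (hG0 : G 0 = 0)
    {L : ℝ} (hL : ∀ s, |deriv G s| ≤ L) :
    IsSobolevZeroPair Ω (fun x => G (v x)) (fun i x => deriv G (v x) * g i x) := by
  obtain ⟨φ, hφ, hae, h1, h2⟩ := h.exists_approx_ae
  have hG' : Continuous (deriv G) := hG.continuous_deriv (by simp)
  have hL0 : 0 ≤ L := (abs_nonneg _).trans (hL 0)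
  have hlip : ∀ s t, ‖G s - G t‖ ≤ L * ‖s - t‖ := fun s t =>
    Convex.norm_image_sub_le_of_norm_deriv_le (fun x _ => hG.differentiable (by simp) x)
      (fun x _ => hL x) convex_univ (Set.mem_univ _) (Set.mem_univ _)
  have hv := h.integrableOn.1
  have hDv : AEStronglyMeasurable (fun x => deriv G (v x)) (volume.restrict Ω) :=
    hG'.comp_aestronglyMeasurable hv
  have scale : ∀ {a : ℕ → ℝ≥0∞}, Tendsto a atTop (𝓝 0) →
      Tendsto (fun m => ENNReal.ofReal L * a m) atTop (𝓝 0) := fun ha => by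
    simpa using ENNReal.Tendsto.const_mul ha (Or.inr ENNReal.ofReal_ne_top)
  refine ⟨?_, fun i => ?_, fun m x => G (φ m x), fun m => (hφ m).comp hG hG0, ?_, fun i => ?_⟩
  · refine (h.integrableOn.norm.const_mul L).mono (hG.continuous.comp_aestronglyMeasurable hv)
      (Eventually.of_forall fun x => ?_)
    have := hlip (v x) 0
    rw [hG0, sub_zero, sub_zero] at this
    exact this.trans (le_abs_self _)
  · exact (h.integrableOn_grad i).bdd_mul hDv (Eventually.of_forall fun x => hL (v x))
  · refine tendsto_of_tendsto_of_tendsto_of_le_of_le tendsto_const_nhds (scale h1)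
      (fun _ => zero_le) fun m => ?_
    exact eLpNorm_le_mul_eLpNorm_of_ae_le_mul (Eventually.of_forall fun x => hlip _ _) 1
  · simp only [classicalPartial_comp hG (hφ _)]
    have hgi := h.integrableOn_grad i
    have hdc : Tendsto (fun m => eLpNorm (fun x => (deriv G (φ m x) - deriv G (v x)) * g i x) 1
        (volume.restrict Ω)) atTop (𝓝 0) := by
      have := tendsto_lintegral_of_dominated_convergence' (μ := volume.restrict Ω)
        (F := fun m x => ‖(deriv G (φ m x) - deriv G (v x)) * g i x‖ₑ) (f := fun _ => 0)
        (fun x => ‖(2 * L) * g i x‖ₑ) ?_ ?_ ?_ ?_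
      · simpa [eLpNorm_one_eq_lintegral_enorm] using this
      · intro m
        exact (((hG'.comp (hφ m).1.continuous).aestronglyMeasurable.sub hDv).mul
          hgi.1).enorm
      · intro m
        refine Eventually.of_forall fun x => ?_
        rw [enorm_le_iff_norm_le, norm_mul, norm_mul]
        refine mul_le_mul_of_nonneg_right ?_ (norm_nonneg _)
        have a1 := hL (φ m x)
        have a2 := hL (v x)
        rw [Real.norm_eq_abs, Real.norm_eq_abs, abs_of_nonneg (by linarith : 0 ≤ 2 * L)]
        have := abs_sub (deriv G (φ m x)) (deriv G (v x))
        linarith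
      · exact (hgi.const_mul (2 * L)).2.ne
      · filter_upwards [hae] with x hx
        have : Tendsto (fun m => (deriv G (φ m x) - deriv G (v x)) * g i x) atTop (𝓝 0) := by
          have := (((hG'.tendsto (v x)).comp hx).sub_const (deriv G (v x))).mul_const (g i x)
          simpa using this
        simpa using this.enorm
    have hsum := (scale (h2 i)).add hdc
    rw [add_zero] at hsum
    refine tendsto_of_tendsto_of_tendsto_of_le_of_le tendsto_const_nhds hsum
      (fun _ => zero_le) fun m => ?_
    have e : (fun x => deriv G (φ m x) * classicalPartial i (φ m) x - deriv G (v x) * g i x)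
        = (fun x => deriv G (φ m x) * (classicalPartial i (φ m) x - g i x))
          + fun x => (deriv G (φ m x) - deriv G (v x)) * g i x := by
      funext x; simp only [Pi.add_apply]; ring
    have hcm : AEStronglyMeasurable (fun x => deriv G (φ m x)) (volume.restrict Ω) :=
      (hG'.comp (hφ m).1.continuous).aestronglyMeasurable
    simp only [e]
    refine (eLpNorm_add_le (hcm.mul
      (((hφ m).continuous_classicalPartial i).aestronglyMeasurable.sub hgi.1))
      ((hcm.sub hDv).mul hgi.1) le_rfl).trans ?_
    refine add_le_add ?_ le_rfl
    refine eLpNorm_le_mul_eLpNorm_of_ae_le_mul (Eventually.of_forall fun x => ?_) 1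
    rw [Pi.mul_apply, norm_mul]
    exact mul_le_mul_of_nonneg_right (hL _) (norm_nonneg _)

end ZeroTrace

/-! ### Hölder estimates on small supports. -/

section Lebesgue

variable {α : Type*} [MeasurableSpace α] {μ : Measure α}

theorem memLp_abs_rpow {f : α → ℝ} {r s : ℝ} (hs : 0 < s)
    (hf : MemLp f (ENNReal.ofReal r) μ) :
    MemLp (fun x => |f x| ^ s) (ENNReal.ofReal (r / s)) μ := by
  have := hf.norm_rpow_div (ENNReal.ofReal s)
  rwa [ENNReal.toReal_ofReal hs.le, ← ENNReal.ofReal_div_of_pos hs] at this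

theorem integrable_mul_of_memLp {f g : α → ℝ} {r s : ℝ} (hrs : r.HolderConjugate s)
    (hf : MemLp f (ENNReal.ofReal r) μ) (hg : MemLp g (ENNReal.ofReal s) μ) :
    Integrable (fun x => f x * g x) μ := by
  have := hrs.ennrealOfReal
  exact hf.integrable_mul hg

theorem eLpNorm_one_le_of_support_subset {f : α → ℝ} {A : Set α} {r : ℝ} (hr : 1 ≤ r)
    (hf : AEStronglyMeasurable f μ) (hA : Function.support f ⊆ A) :
    eLpNorm f 1 μ ≤ eLpNorm f (ENNReal.ofReal r) μ * μ A ^ (1 - 1 / r) := by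
  have h1 : eLpNorm f 1 (μ.restrict A) = eLpNorm f 1 μ := by
    rw [eLpNorm_one_eq_lintegral_enorm, eLpNorm_one_eq_lintegral_enorm]
    refine setLIntegral_eq_of_support_subset ?_
    intro x hx
    refine hA ?_
    simpa using hx
  rw [← h1]
  have h2 := eLpNorm_le_eLpNorm_mul_rpow_measure_univ (μ := μ.restrict A) (f := f)
    (p := 1) (q := ENNReal.ofReal r) (by simpa using hr) hf.restrict
  rw [ENNReal.toReal_ofReal (by linarith), ENNReal.toReal_one, Measure.restrict_apply_univ,
    div_one] at h2
  exact h2.trans (mul_le_mul_left (eLpNorm_mono_measure _ Measure.restrict_le_self) _)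

/-- Hölder is used twice: for `H`, gaining μ(A)^(1-p/q) and so μ(A)^(1/p-1/q) after the p-th root;
then from L^p to L^1, gaining μ(A)^(1-1/p). The exponents add up to 1 - 1/q. -/
theorem eLpNorm_weighted_le [IsFiniteMeasure μ] {p q L C : ℝ} (hp : 1 < p) (hpq : p < q)
    (hL : 0 ≤ L) (hC : 0 ≤ C) {A : Set α} {γ d H : α → ℝ} (hγm : AEStronglyMeasurable γ μ)
    (hγ0 : ∀ x, 0 ≤ γ x) (hγL : ∀ x, γ x ≤ L) (hγA : Function.support γ ⊆ A)
    (hd : MemLp d (ENNReal.ofReal p) μ) (hH : MemLp H (ENNReal.ofReal (q / p)) μ)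
    (hen : ∫ x, γ x * |d x| ^ p ∂μ ≤ C * ∫ x, γ x * H x ∂μ) :
    eLpNorm (fun x => γ x * d x) 1 μ ≤
      (ENNReal.ofReal (L ^ p * C) * eLpNorm H (ENNReal.ofReal (q / p)) μ) ^ (1 / p)
        * μ A ^ (1 - 1 / q) := by
  have hp0 : 0 < p := by linarith
  have hq0 : 0 < q := by linarith
  have hqp : 1 ≤ q / p := by rw [le_div_iff₀ hp0]; linarith
  have hγb : ∀ x, ‖γ x‖ ≤ L := fun x => by rw [Real.norm_of_nonneg (hγ0 x)]; exact hγL x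
  have hsupp : ∀ e : α → ℝ, Function.support (fun x => γ x * e x) ⊆ A := fun e =>
    (Function.support_mul_subset_left γ e).trans hγA
  have hHint : Integrable (fun x => γ x * H x) μ :=
    (hH.integrable (by simpa using hqp)).bdd_mul hγm (Eventually.of_forall hγb)
  have hdp : Integrable (fun x => |d x| ^ p) μ := by
    have := memLp_abs_rpow hp0 hd
    rw [div_self hp0.ne', ENNReal.ofReal_one] at this
    exact memLp_one_iff_integrable.1 this
  have hdint : Integrable (fun x => γ x * |d x| ^ p) μ :=
    hdp.bdd_mul hγm (Eventually.of_forall hγb)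
  have s1 : eLpNorm (fun x => γ x * H x) 1 μ ≤
      ENNReal.ofReal L * eLpNorm H (ENNReal.ofReal (q / p)) μ * μ A ^ (1 - p / q) := by
    refine (eLpNorm_one_le_of_support_subset hqp (hγm.mul hH.1) (hsupp H)).trans ?_
    rw [one_div_div]
    gcongr
    refine eLpNorm_le_mul_eLpNorm_of_ae_le_mul (Eventually.of_forall fun x => ?_) _
    rw [Pi.mul_apply, norm_mul]
    exact mul_le_mul_of_nonneg_right (hγb x) (norm_nonneg _)
  have s2 : ENNReal.ofReal (∫ x, γ x * H x ∂μ) ≤ eLpNorm (fun x => γ x * H x) 1 μ := by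
    rw [eLpNorm_one_eq_lintegral_enorm, ← ofReal_integral_norm_eq_lintegral_enorm hHint]
    exact ENNReal.ofReal_le_ofReal (integral_mono hHint hHint.norm fun x => le_abs_self _)
  -- From 0 ≤ γ ≤ L follows γ^p ≤ L^(p-1) γ, so an energy carrying a single factor γ controls the
  -- L^p norm of γd.
  have s3 : eLpNorm (fun x => γ x * d x) (ENNReal.ofReal p) μ ^ p ≤
      ENNReal.ofReal (L ^ (p - 1)) * ENNReal.ofReal (∫ x, γ x * |d x| ^ p ∂μ) := by
    rw [eLpNorm_eq_lintegral_rpow_enorm_toReal (by simpa using hp0) ENNReal.ofReal_ne_top,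
      ENNReal.toReal_ofReal hp0.le, ← ENNReal.rpow_mul, one_div_mul_cancel hp0.ne',
      ENNReal.rpow_one, ← ENNReal.ofReal_mul (Real.rpow_nonneg hL _), ← integral_const_mul,
      ofReal_integral_eq_lintegral_ofReal (hdint.const_mul _) (Eventually.of_forall fun x =>
        mul_nonneg (Real.rpow_nonneg hL _) (mul_nonneg (hγ0 x)
          (Real.rpow_nonneg (abs_nonneg _) _)))]
    refine lintegral_mono fun x => ?_
    rw [← ofReal_norm, ENNReal.ofReal_rpow_of_nonneg (norm_nonneg _) hp0.le]
    refine ENNReal.ofReal_le_ofReal ?_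
    rw [norm_mul, Real.norm_of_nonneg (hγ0 x), Real.norm_eq_abs,
      Real.mul_rpow (hγ0 x) (abs_nonneg _), ← mul_assoc]
    refine mul_le_mul_of_nonneg_right ?_ (Real.rpow_nonneg (abs_nonneg _) _)
    have : γ x ^ p = γ x ^ (p - 1) * γ x := by
      rw [← Real.rpow_add_one' (hγ0 x) (by linarith)]; congr 1; ring
    rw [this]
    exact mul_le_mul_of_nonneg_right
      (Real.rpow_le_rpow (hγ0 x) (hγL x) (by linarith)) (hγ0 x)
  have s4 : eLpNorm (fun x => γ x * d x) (ENNReal.ofReal p) μ ^ p ≤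
      ENNReal.ofReal (L ^ p * C) * eLpNorm H (ENNReal.ofReal (q / p)) μ * μ A ^ (1 - p / q) := by
    calc _ ≤ ENNReal.ofReal (L ^ (p - 1)) * ENNReal.ofReal (C * ∫ x, γ x * H x ∂μ) :=
          s3.trans (by gcongr)
      _ ≤ ENNReal.ofReal (L ^ (p - 1)) * (ENNReal.ofReal C *
          (ENNReal.ofReal L * eLpNorm H (ENNReal.ofReal (q / p)) μ * μ A ^ (1 - p / q))) := by
          rw [ENNReal.ofReal_mul hC]
          gcongr
          exact s2.trans s1
      _ = _ := by
          have : L ^ p = L ^ (p - 1) * L := by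
            rw [← Real.rpow_add_one' hL (by linarith)]; congr 1; ring
          rw [this, ENNReal.ofReal_mul (mul_nonneg (Real.rpow_nonneg hL _) hL),
            ENNReal.ofReal_mul (Real.rpow_nonneg hL _)]
          ring
  have s5 : eLpNorm (fun x => γ x * d x) (ENNReal.ofReal p) μ ≤
      (ENNReal.ofReal (L ^ p * C) * eLpNorm H (ENNReal.ofReal (q / p)) μ) ^ (1 / p)
        * μ A ^ (1 / p - 1 / q) := by
    rw [← ENNReal.rpow_le_rpow_iff hp0]
    refine s4.trans (le_of_eq ?_)
    rw [ENNReal.mul_rpow_of_nonneg _ _ hp0.le, ← ENNReal.rpow_mul, ← ENNReal.rpow_mul,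
      one_div_mul_cancel hp0.ne', ENNReal.rpow_one]
    congr 2
    field_simp
  refine (eLpNorm_one_le_of_support_subset hp.le (hγm.mul hd.1) (hsupp d)).trans ?_
  refine (mul_le_mul_left s5 _).trans (le_of_eq ?_)
  rw [mul_assoc, ← ENNReal.rpow_add_of_nonneg]
  · congr 2; ring
  · rw [sub_nonneg]; exact one_div_le_one_div_of_le hp0 hpq.le
  · rw [sub_nonneg, div_le_one hp0]; exact hp.le

end Lebesgue

/-! ### Composition with Carathéodory functions. -/

section Caratheodory

variable {n : ℕ} {Ω : Set (E n)}

/-- For simple `Z` the composition is a finite sum of pieces `b x z` with z frozen; continuity in z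
handles the limit. -/
theorem IsCaratheodory.aestronglyMeasurable_comp {b : E n → E n → ℝ} (hb : IsCaratheodory Ω b)
    {Z : E n → E n} (hZ : AEStronglyMeasurable Z (volume.restrict Ω)) :
    AEStronglyMeasurable (fun x => b x (Z x)) (volume.restrict Ω) := by
  have hs := hZ.stronglyMeasurable_mk
  refine aestronglyMeasurable_of_tendsto_ae atTop (f := fun m x => b x (hs.approx m x)) ?_ ?_
  · intro m
    have e : (fun x => b x (hs.approx m x)) = fun x => ∑ z ∈ (hs.approx m).range,
        ((hs.approx m) ⁻¹' {z}).indicator (fun x => b x z) x := by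
      funext x
      rw [Finset.sum_eq_single (hs.approx m x)]
      · rw [Set.indicator_of_mem (by simp)]
      · intro z _ hz
        rw [Set.indicator_of_notMem]
        simpa using hz.symm
      · intro hx
        exact absurd (SimpleFunc.mem_range_self _ x) hx
    rw [e]
    exact Finset.aestronglyMeasurable_fun_sum _ fun z _ =>
      (hb.1 z).indicator ((hs.approx m).measurableSet_preimage _)
  · filter_upwards [hb.2, hZ.ae_eq_mk] with x hx hxe
    rw [hxe]
    exact (hx.tendsto _).comp (hs.tendsto_approx x)

theorem aestronglyMeasurable_toLp {μ : Measure (E n)} {Z : Fin n → E n → ℝ}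
    (hZ : ∀ i, AEStronglyMeasurable (Z i) μ) :
    AEStronglyMeasurable (fun x => (WithLp.toLp 2 fun i => Z i x : E n)) μ :=
  (PiLp.continuous_toLp 2 _).comp_aestronglyMeasurable
    (aemeasurable_pi_lambda _ fun i => (hZ i).aemeasurable).aestronglyMeasurable

/-- The exponent is (r/p)/(1 - 1/p) = r/(p-1). It serves with r = q for Dθ_* and with r = p for Du.
-/
theorem IsCaratheodory.memLp_comp {b : E n → E n → ℝ} (hb : IsCaratheodory Ω b) {p r c : ℝ}
    (hp : 1 < p) {h : E n → ℝ} (hh0 : ∀ᵐ x ∂(volume.restrict Ω), 0 ≤ h x)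
    (hh : MemLp h (ENNReal.ofReal (r / p)) (volume.restrict Ω))
    (hgrowth : ∀ᵐ x ∂(volume.restrict Ω), ∀ z : E n,
      |b x z| ≤ c * (h x + ∑ j, |z j| ^ p) ^ (1 - 1 / p))
    {Z : Fin n → E n → ℝ} (hZ : ∀ i, MemLp (Z i) (ENNReal.ofReal r) (volume.restrict Ω)) :
    MemLp (fun x => b x (WithLp.toLp 2 fun i => Z i x)) (ENNReal.ofReal (r / (p - 1)))
      (volume.restrict Ω) := by
  have hp0 : 0 < p := by linarith
  have hs : 0 < 1 - 1 / p := by rw [sub_pos, div_lt_one hp0]; exact hp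
  have hK : MemLp (fun x => h x + ∑ j, |Z j x| ^ p) (ENNReal.ofReal (r / p))
      (volume.restrict Ω) := by
    refine hh.add ?_
    exact memLp_finsetSum _ fun j _ => memLp_abs_rpow hp0 (hZ j)
  have hK2 := memLp_abs_rpow hs hK
  have e : r / p / (1 - 1 / p) = r / (p - 1) := by
    have : p - 1 ≠ 0 := by linarith
    field_simp
  rw [e] at hK2
  refine hK2.of_le_mul (c := c)
    (hb.aestronglyMeasurable_comp (aestronglyMeasurable_toLp fun i => (hZ i).1)) ?_
  filter_upwards [hh0, hgrowth] with x hx0 hx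
  have hnn : 0 ≤ h x + ∑ j, |Z j x| ^ p :=
    add_nonneg hx0 (Finset.sum_nonneg fun j _ => Real.rpow_nonneg (abs_nonneg _) _)
  rw [Real.norm_eq_abs, Real.norm_of_nonneg (Real.rpow_nonneg (abs_nonneg _) _), abs_of_nonneg hnn]
  exact hx _

end Caratheodory

/-! ### Young's inequality with a small coefficient. -/

section Energy

theorem exists_young_const {p ε : ℝ} (hp : 1 < p) (hε : 0 < ε) :
    ∃ C : ℝ, 0 ≤ C ∧ ∀ F d : ℝ, F * d ≤ ε * |d| ^ p + C * |F| ^ (p / (p - 1)) := by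
  have hp0 : 0 < p := by linarith
  have hpp : p.HolderConjugate (p / (p - 1)) := Real.HolderConjugate.conjExponent hp
  -- Young is applied to (δd)(F/δ), with δ^p = ε; the factors 1/p and 1/p' are dropped.
  set δ := ε ^ (1 / p) with hδ
  have hδ0 : 0 < δ := Real.rpow_pos_of_pos hε _
  have hδp : δ ^ p = ε := by
    rw [hδ, ← Real.rpow_mul hε.le, one_div_mul_cancel hp0.ne', Real.rpow_one]
  refine ⟨(δ⁻¹) ^ (p / (p - 1)), by positivity, fun F d => ?_⟩
  have hy := Real.young_inequality (δ * d) (δ⁻¹ * F) hpp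
  have e1 : δ * d * (δ⁻¹ * F) = F * d := by field_simp
  rw [e1, abs_mul, abs_mul, abs_of_pos hδ0, abs_of_pos (inv_pos.2 hδ0),
    Real.mul_rpow hδ0.le (abs_nonneg _), Real.mul_rpow (inv_pos.2 hδ0).le (abs_nonneg _), hδp] at hy
  refine hy.trans (add_le_add ?_ ?_)
  · exact div_le_self (by positivity) hp.le
  · exact div_le_self (by positivity) hpp.symm.lt.le

end Energy

/-! ### The Sobolev inequality in W_0^{1,1}. -/

section Sobolev

variable {n : ℕ} {Ω : Set (E n)}

theorem norm_le_sum_norm_apply_single (T : E n →L[ℝ] ℝ) :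
    ‖T‖ ≤ ∑ i, ‖T (EuclideanSpace.single i (1 : ℝ))‖ := by
  refine T.opNorm_le_bound (Finset.sum_nonneg fun _ _ => norm_nonneg _) fun x => ?_
  have hx : x = ∑ i, x i • EuclideanSpace.single i (1 : ℝ) := by
    ext j
    simp [Finset.sum_apply, Pi.single_apply]
  conv_lhs => rw [hx, map_sum]
  rw [Finset.sum_mul]
  refine (norm_sum_le _ _).trans (Finset.sum_le_sum fun i _ => ?_)
  rw [map_smul, norm_smul, mul_comm]
  exact mul_le_mul_of_nonneg_left (PiLp.norm_apply_le x i) (norm_nonneg _)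

/-- The Gagliardo–Nirenberg–Sobolev inequality for the approximating test functions passes to the
limit by Fatou. -/
theorem exists_sobolev_const (hn : 2 ≤ n) :
    ∃ C : ℝ≥0∞, C ≠ ⊤ ∧ ∀ (Ω : Set (E n)) (v : E n → ℝ) (g : Fin n → E n → ℝ), IsOpen Ω →
      IsSobolevZeroPair Ω v g → eLpNorm v (ENNReal.ofReal (n / (n - 1))) (volume.restrict Ω) ≤
        C * ∑ i, eLpNorm (g i) 1 (volume.restrict Ω) := by
  have hn1 : (1 : ℝ) < n := by exact_mod_cast hn
  have hconj : (n : ℝ).HolderConjugate (n / (n - 1)) := Real.HolderConjugate.conjExponent hn1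
  set p : NNReal := Real.toNNReal (n / (n - 1)) with hpdef
  have hp : ((Module.finrank ℝ (E n) : ℕ) : NNReal).HolderConjugate p := by
    have := hconj.toNNReal
    rwa [Real.toNNReal_natCast, ← hpdef, ← finrank_euclideanSpace_fin (𝕜 := ℝ) (n := n)] at this
  refine ⟨((eLpNormLESNormFDerivOneConst (volume : Measure (E n)) p : NNReal) : ℝ≥0∞), ENNReal.coe_ne_top,
    fun Ω v g hΩ h => ?_⟩
  set K : ℝ≥0∞ := ((eLpNormLESNormFDerivOneConst (volume : Measure (E n)) p : NNReal) : ℝ≥0∞) with hK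
  obtain ⟨φ, hφ, hae, -, h2⟩ := h.exists_approx_ae
  have hfatou := Lp.eLpNorm_lim_le_liminf_eLpNorm (p := (p : ℝ≥0∞)) (μ := volume.restrict Ω)
    (fun m => (hφ m).1.continuous.aestronglyMeasurable) v hae
  refine hfatou.trans ?_
  have hb : ∀ m, eLpNorm (φ m) p (volume.restrict Ω) ≤ K * ∑ i,
      (eLpNorm (fun x => classicalPartial i (φ m) x - g i x) 1 (volume.restrict Ω)
        + eLpNorm (g i) 1 (volume.restrict Ω)) := by
    intro m
    refine (eLpNorm_mono_measure _ Measure.restrict_le_self).trans ?_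
    refine (eLpNorm_le_eLpNorm_fderiv_one volume ((hφ m).1.of_le (by simp)) (hφ m).2.1 hp).trans ?_
    rw [← hK]
    gcongr
    have e : eLpNorm (fderiv ℝ (φ m)) 1 volume
        = eLpNorm (fderiv ℝ (φ m)) 1 (volume.restrict Ω) := by
      rw [eLpNorm_one_eq_lintegral_enorm, eLpNorm_one_eq_lintegral_enorm]
      refine (setLIntegral_eq_of_support_subset ?_).symm
      intro x hx
      by_contra hxΩ
      refine hx ?_
      change ‖fderiv ℝ (φ m) x‖ₑ = 0
      rw [(hφ m).fderiv_eq_zero_of_notMem hxΩ, ← ofReal_norm, norm_zero, ENNReal.ofReal_zero]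
    rw [e]
    calc eLpNorm (fderiv ℝ (φ m)) 1 (volume.restrict Ω)
        ≤ ∑ i, eLpNorm (fun x => classicalPartial i (φ m) x) 1 (volume.restrict Ω) := by
          simp only [eLpNorm_one_eq_lintegral_enorm]
          rw [← lintegral_finsetSum']
          · refine lintegral_mono fun x => ?_
            simp only [← ofReal_norm]
            rw [← ENNReal.ofReal_sum_of_nonneg fun _ _ => norm_nonneg _]
            exact ENNReal.ofReal_le_ofReal (norm_le_sum_norm_apply_single _)
          · intro i _
            exact ((hφ m).continuous_classicalPartial i).aestronglyMeasurable.enorm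
      _ ≤ _ := by
          refine Finset.sum_le_sum fun i _ => ?_
          have e2 : (fun x => classicalPartial i (φ m) x)
              = (fun x => classicalPartial i (φ m) x - g i x) + g i := by
            funext x; simp
          conv_lhs => rw [e2]
          exact eLpNorm_add_le
            (((hφ m).continuous_classicalPartial i).aestronglyMeasurable.sub
              (h.integrableOn_grad i).1) (h.integrableOn_grad i).1 le_rfl
  have hlim : Tendsto (fun m => K * ∑ i,
      (eLpNorm (fun x => classicalPartial i (φ m) x - g i x) 1 (volume.restrict Ω)
        + eLpNorm (g i) 1 (volume.restrict Ω))) atTop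
      (𝓝 (K * ∑ i, eLpNorm (g i) 1 (volume.restrict Ω))) := by
    refine ENNReal.Tendsto.const_mul (tendsto_finsetSum _ fun i _ => ?_)
      (Or.inr ENNReal.coe_ne_top)
    simpa using (h2 i).add_const (eLpNorm (g i) 1 (volume.restrict Ω))
  exact (liminf_le_liminf (Eventually.of_forall hb)).trans hlim.liminf_eq.le

end Sobolev

/-! ### Smooth tail functions. -/

section Truncation

/-- A smooth function which vanishes on `[-1, 1]` and is the identity outside `[-2, 2]`. -/
theorem exists_smooth_tail : ∃ (G : ℝ → ℝ) (L : ℝ), ContDiff ℝ ∞ G ∧ 0 ≤ L ∧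
    (∀ s, 0 ≤ deriv G s) ∧ (∀ s, deriv G s ≤ L) ∧ (∀ s, |s| ≤ 1 → deriv G s = 0) ∧
    (∀ s, 0 ≤ s → 0 ≤ G s ∧ G s ≤ s) ∧ (∀ s, s ≤ 0 → s ≤ G s ∧ G s ≤ 0) ∧
    (∀ s, 2 ≤ |s| → G s = s) := by
  have hT : ContDiff ℝ ∞ Real.smoothTransition := Real.smoothTransition.contDiff
  set G : ℝ → ℝ := fun s => s * Real.smoothTransition (s ^ 2 - 1) with hGdef
  have hG : ContDiff ℝ ∞ G := by
    refine contDiff_id.mul (hT.comp ?_)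
    fun_prop
  have hder : ∀ s, deriv G s = Real.smoothTransition (s ^ 2 - 1) + s * (deriv Real.smoothTransition (s ^ 2 - 1) * (2 * s)) := by
    intro s
    have h1 : HasDerivAt Real.smoothTransition (deriv Real.smoothTransition (s ^ 2 - 1)) (s ^ 2 - 1) :=
      (hT.differentiable (by simp) _).hasDerivAt
    have h2 : HasDerivAt (fun s : ℝ => s ^ 2 - 1) (2 * s) s := by
      simpa using (hasDerivAt_pow 2 s).sub_const 1
    have h3 := (hasDerivAt_id s).mul (h1.comp s h2)
    have h4 : deriv G s = _ := h3.deriv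
    rw [h4]
    simp
  have hmono : Monotone Real.smoothTransition := Real.smoothTransition.monotone
  have hT' : ∀ x, 0 ≤ deriv Real.smoothTransition x := fun x => hmono.deriv_nonneg
  -- The transition attains its minimum at every x ≤ 0, which includes the endpoint x = 0 needed
  -- when |s| = 1.
  have hT0 : ∀ x, x ≤ 0 → deriv Real.smoothTransition x = 0 := fun x hx => by
    refine IsLocalMin.deriv_eq_zero (Eventually.of_forall fun y => ?_)
    rw [Real.smoothTransition.zero_of_nonpos hx]
    exact Real.smoothTransition.nonneg y
  have hT1 : ∀ x, 1 ≤ x → deriv Real.smoothTransition x = 0 := fun x hx => by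
    refine IsLocalMax.deriv_eq_zero (Eventually.of_forall fun y => ?_)
    rw [Real.smoothTransition.one_of_one_le hx]
    exact Real.smoothTransition.le_one y
  obtain ⟨B, hB⟩ := (isCompact_Icc (a := (-2 : ℝ)) (b := 2)).exists_bound_of_continuousOn
    (hG.continuous_deriv (by simp)).continuousOn
  -- G' is bounded by `B` on the compact [-2, 2]; outside it G' = 1.
  refine ⟨G, max B 1, hG, le_max_of_le_right zero_le_one, ?_, ?_, ?_, ?_, ?_, ?_⟩
  · intro s
    rw [hder]
    have := hT' (s ^ 2 - 1)
    have h2 := Real.smoothTransition.nonneg (s ^ 2 - 1)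
    have : s * (deriv Real.smoothTransition (s ^ 2 - 1) * (2 * s)) = 2 * s ^ 2 * deriv Real.smoothTransition (s ^ 2 - 1) := by ring
    rw [this]
    positivity
  · intro s
    by_cases hs : s ∈ Set.Icc (-2 : ℝ) 2
    · exact (le_abs_self _).trans ((hB s hs).trans (le_max_left _ _))
    · have : 1 ≤ s ^ 2 - 1 := by
        rw [Set.mem_Icc, ← abs_le, not_le] at hs
        have := sq_abs s
        nlinarith
      rw [hder, hT1 _ this]
      have := Real.smoothTransition.le_one (s ^ 2 - 1)
      simpa using Or.inr this
  · intro s hs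
    have : s ^ 2 - 1 ≤ 0 := by
      have := (sq_le_one_iff_abs_le_one s).2 hs
      linarith
    rw [hder, hT0 _ this]
    rw [Real.smoothTransition.zero_of_nonpos this]
    simp
  · intro s hs
    exact ⟨mul_nonneg hs (Real.smoothTransition.nonneg _),
      mul_le_of_le_one_right hs (Real.smoothTransition.le_one _)⟩
  · intro s hs
    refine ⟨?_, mul_nonpos_of_nonpos_of_nonneg hs (Real.smoothTransition.nonneg _)⟩
    have h1 := Real.smoothTransition.le_one (s ^ 2 - 1)
    change s ≤ s * Real.smoothTransition (s ^ 2 - 1)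
    nlinarith
  · intro s hs
    have : 1 ≤ s ^ 2 - 1 := by
      have := sq_abs s
      nlinarith
    change s * Real.smoothTransition (s ^ 2 - 1) = s
    rw [Real.smoothTransition.one_of_one_le this, mul_one]

/-- The rescaled smooth tails, with a bound on the derivative that does not depend on `k`. -/
theorem exists_smooth_tail_scaled : ∃ L : ℝ, 0 ≤ L ∧ ∀ k : ℝ, 0 < k → ∃ G : ℝ → ℝ,
    ContDiff ℝ ∞ G ∧ (∀ s, 0 ≤ deriv G s) ∧ (∀ s, deriv G s ≤ L) ∧
    (∀ s, |s| ≤ k → deriv G s = 0) ∧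
    (∀ s, 0 ≤ s → 0 ≤ G s ∧ G s ≤ s) ∧ (∀ s, s ≤ 0 → s ≤ G s ∧ G s ≤ 0) ∧
    (∀ s, 2 * k ≤ |s| → G s = s) := by
  obtain ⟨G, L, hG, hL, h1, h2, h3, h4, h5, h6⟩ := exists_smooth_tail
  -- The derivative of k G(s/k) is G'(s/k), so the bound `L` survives the scaling.
  refine ⟨L, hL, fun k hk => ⟨fun s => k * G (s / k), ?_, ?_⟩⟩
  · exact contDiff_const.mul (hG.comp (contDiff_id.div_const k))
  have hder : ∀ s, deriv (fun s => k * G (s / k)) s = deriv G (s / k) := by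
    intro s
    have a1 : HasDerivAt G (deriv G (s / k)) (s / k) :=
      (hG.differentiable (by simp) _).hasDerivAt
    have a2 := (a1.comp s ((hasDerivAt_id s).div_const k)).const_mul k
    have a3 : deriv (fun s => k * G (s / k)) s = _ := a2.deriv
    rw [a3]
    field_simp
  have hk' : ∀ s, k * (s / k) = s := fun s => mul_div_cancel₀ s hk.ne'
  simp only [hder]
  refine ⟨fun s => h1 _, fun s => h2 _, fun s hs => h3 _ ?_, fun s hs => ?_, fun s hs => ?_,
    fun s hs => ?_⟩
  · rw [abs_div, abs_of_pos hk]
    exact (div_le_one hk).2 hs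
  · obtain ⟨b1, b2⟩ := h4 (s / k) (div_nonneg hs hk.le)
    refine ⟨mul_nonneg hk.le b1, ?_⟩
    have := mul_le_mul_of_nonneg_left b2 hk.le
    rwa [hk'] at this
  · obtain ⟨b1, b2⟩ := h5 (s / k) (div_nonpos_of_nonpos_of_nonneg hs hk.le)
    refine ⟨?_, mul_nonpos_of_nonneg_of_nonpos hk.le b2⟩
    have := mul_le_mul_of_nonneg_left b1 hk.le
    rwa [hk'] at this
  · rw [h6, hk']
    rw [abs_div, abs_of_pos hk]
    exact (le_div_iff₀ hk).2 hs

end Truncation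

/-! ### Decay by dyadic iteration. -/

section Iteration

/-- A Stampacchia type lemma for dyadic decay with a sublinear power. -/
theorem exists_rpow_decay_of_doubling {m : ℝ → ℝ} {C M α β : ℝ} (hC : 0 ≤ C) (hβ0 : 0 ≤ β)
    (hβ : β < 1) (hα : 0 < α) (hm0 : ∀ k, 0 ≤ m k) (hmM : ∀ k, m k ≤ M)
    (hanti : Antitone m) (hm : ∀ k, 0 < k → m (2 * k) ≤ C * k ^ (-α) * m k ^ β) :
    ∃ K : ℝ, 0 < K ∧ ∀ τ, 0 < τ → m τ ≤ K / τ ^ (α / (1 - β)) := by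
  set t := α / (1 - β) with ht
  have h1β : 0 < 1 - β := by linarith
  have ht0 : 0 < t := div_pos hα h1β
  -- The exponent t is the fixed point of t = α + tβ: a bound of order k^(-t) for m(k) reproduces
  -- itself at 2k.
  have htα : t = α + t * β := by rw [ht]; field_simp; ring
  -- The bound by `M` starts the induction at level 1; the last term gives C 2^t K^β ≤ K, possible
  -- since β < 1.
  set K := max (max 1 M) ((C * 2 ^ t) ^ (1 / (1 - β))) with hK
  have hK1 : 1 ≤ K := (le_max_left _ _).trans (le_max_left _ _)
  have hKM : M ≤ K := (le_max_right _ _).trans (le_max_left _ _)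
  have hK0 : 0 < K := by linarith
  have hKC : C * 2 ^ t ≤ K ^ (1 - β) := by
    have h0 : 0 ≤ C * 2 ^ t := by positivity
    have := Real.rpow_le_rpow (by positivity) (le_max_right (max 1 M) ((C * 2 ^ t) ^ (1 / (1 - β))))
      h1β.le
    rwa [← Real.rpow_mul h0, one_div_mul_cancel h1β.ne', Real.rpow_one, ← hK] at this
  have step : ∀ k, 0 < k → m k ≤ K / k ^ t → m (2 * k) ≤ K / (2 * k) ^ t := by
    intro k hk hmk
    have hkt : 0 < k ^ t := Real.rpow_pos_of_pos hk _
    calc m (2 * k) ≤ C * k ^ (-α) * m k ^ β := hm k hk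
      _ ≤ C * k ^ (-α) * (K / k ^ t) ^ β := by
        have := Real.rpow_le_rpow (hm0 k) hmk hβ0
        gcongr
      _ = C * K ^ β / k ^ t := by
        rw [Real.div_rpow hK0.le hkt.le, ← Real.rpow_mul hk.le, Real.rpow_neg hk.le]
        conv_rhs => rw [htα, Real.rpow_add hk]
        field_simp
      _ ≤ K / (2 * k) ^ t := by
        rw [Real.mul_rpow zero_le_two hk.le, div_le_div_iff₀ hkt (by positivity)]
        have e : K = K ^ (1 - β) * K ^ β := by
          rw [← Real.rpow_add hK0]; simp
        calc C * K ^ β * (2 ^ t * k ^ t) = (C * 2 ^ t) * (K ^ β * k ^ t) := by ring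
          _ ≤ K ^ (1 - β) * (K ^ β * k ^ t) := by gcongr
          _ = K * k ^ t := by conv_rhs => rw [e]
                              ring
  have dyadic : ∀ j : ℕ, m (2 ^ j) ≤ K / ((2 : ℝ) ^ j) ^ t := by
    intro j
    induction j with
    | zero => simpa using (hmM 1).trans hKM
    | succ j ih => rw [pow_succ']; exact step _ (by positivity) ih
  refine ⟨K * 2 ^ t, by positivity, fun τ hτ => ?_⟩
  have h2t : 1 ≤ (2 : ℝ) ^ t := Real.one_le_rpow one_le_two ht0.le
  rw [le_div_iff₀ (by positivity)]
  -- For τ ≥ 1, monotonicity between 2^j ≤ τ < 2^(j+1) costs a factor 2^t; for τ < 1 the bound `M`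
  -- is enough.
  rcases le_or_gt 1 τ with h1 | h1
  · obtain ⟨j, hj1, hj2⟩ := exists_nat_pow_near h1 one_lt_two
    calc m τ * τ ^ t ≤ K / ((2 : ℝ) ^ j) ^ t * (2 ^ (j + 1)) ^ t := by
          have a1 := (hanti hj1).trans (dyadic j)
          have a2 := Real.rpow_le_rpow hτ.le hj2.le ht0.le
          have := hm0 τ
          gcongr
      _ = K * 2 ^ t := by
          rw [pow_succ, Real.mul_rpow (by positivity) (by positivity)]
          have : (0 : ℝ) < (2 ^ j) ^ t := by positivity
          field_simp
  · have a1 : τ ^ t ≤ 1 := Real.rpow_le_one hτ.le h1.le ht0.le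
    have a2 := (hmM τ).trans hKM
    calc m τ * τ ^ t ≤ K * 1 := by
          gcongr
      _ ≤ K * 2 ^ t := by gcongr

end Iteration

/-! ### The weighted energy estimate and the competitor. -/

section Energy

/-- Here B = a(x, Du), A = a(x, Dθ_*) and d = Du - Dθ_*. Write (B - A)·d = (B - f)·d + (f - A)·d:
after weighting by γ the first term has nonpositive integral by `htest`, and Young absorbs half of
ν∑|d_i|^p from the second. -/
theorem integral_weighted_rpow_le {α ι : Type*} [Fintype ι] [MeasurableSpace α] {μ : Measure α}
    {p ν C L : ℝ} (hp : 1 < p) (hν : 0 < ν)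
    (hC : ∀ F d : ℝ, F * d ≤ ν / 2 * |d| ^ p + C * |F| ^ (p / (p - 1)))
    {γ : α → ℝ} (hγm : AEStronglyMeasurable γ μ) (hγ0 : ∀ x, 0 ≤ γ x) (hγL : ∀ x, γ x ≤ L)
    {d f A B : ι → α → ℝ} (hd : ∀ i, MemLp (d i) (ENNReal.ofReal p) μ)
    (hf : ∀ i, MemLp (f i) (ENNReal.ofReal (p / (p - 1))) μ)
    (hA : ∀ i, MemLp (A i) (ENNReal.ofReal (p / (p - 1))) μ)
    (hB : ∀ i, MemLp (B i) (ENNReal.ofReal (p / (p - 1))) μ)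
    (hmono : ∀ᵐ x ∂μ, ν * ∑ i, |d i x| ^ p ≤ ∑ i, (B i x - A i x) * d i x)
    (htest : ∫ x, ∑ i, B i x * (γ x * d i x) ∂μ ≤ ∫ x, ∑ i, f i x * (γ x * d i x) ∂μ) (j : ι) :
    ∫ x, γ x * |d j x| ^ p ∂μ ≤
      (2 * C / ν) * ∫ x, γ x * ∑ i, |f i x - A i x| ^ (p / (p - 1)) ∂μ := by
  have hp0 : 0 < p := by linarith
  have hpp : p.HolderConjugate (p / (p - 1)) := Real.HolderConjugate.conjExponent hp
  have hpp0 : 0 < p / (p - 1) := hpp.symm.pos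
  have hγb : ∀ᵐ x ∂μ, ‖γ x‖ ≤ L :=
    Eventually.of_forall fun x => by rw [Real.norm_of_nonneg (hγ0 x)]; exact hγL x
  have pow_int : ∀ {g : α → ℝ} {r : ℝ}, 0 < r → MemLp g (ENNReal.ofReal r) μ →
      Integrable (fun x => |g x| ^ r) μ := fun {g r} hr hg => by
    have := memLp_abs_rpow hr hg
    rw [div_self hr.ne', ENNReal.ofReal_one] at this
    exact memLp_one_iff_integrable.1 this
  have prod_int : ∀ {g : ι → α → ℝ}, (∀ i, MemLp (g i) (ENNReal.ofReal (p / (p - 1))) μ) →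
      Integrable (fun x => ∑ i, g i x * (γ x * d i x)) μ := fun {g} hg => by
    refine integrable_finsetSum _ fun i _ => ?_
    have := (integrable_mul_of_memLp hpp.symm (hg i) (hd i)).bdd_mul hγm hγb
    refine this.congr (Eventually.of_forall fun x => ?_)
    simp only; ring
  have dint : ∀ i, Integrable (fun x => γ x * |d i x| ^ p) μ := fun i =>
    (pow_int hp0 (hd i)).bdd_mul hγm hγb
  have Hint : Integrable (fun x => γ x * ∑ i, |f i x - A i x| ^ (p / (p - 1))) μ :=
    (integrable_finsetSum _ fun i _ => pow_int hpp0 ((hf i).sub (hA i))).bdd_mul hγm hγb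
  have key : ∫ x, ν / 2 * (γ x * |d j x| ^ p) ∂μ ≤
      ∫ x, ((∑ i, B i x * (γ x * d i x)) - (∑ i, f i x * (γ x * d i x))
        + C * (γ x * ∑ i, |f i x - A i x| ^ (p / (p - 1)))) ∂μ := by
    refine integral_mono_ae ((dint j).const_mul _)
      (((prod_int hB).sub (prod_int hf)).add (Hint.const_mul C)) ?_
    filter_upwards [hmono] with x hx
    have h1 : ∑ i, (f i x - A i x) * d i x ≤ ν / 2 * ∑ i, |d i x| ^ p
        + C * ∑ i, |f i x - A i x| ^ (p / (p - 1)) := by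
      rw [Finset.mul_sum, Finset.mul_sum, ← Finset.sum_add_distrib]
      exact Finset.sum_le_sum fun i _ => hC _ _
    have h2 : |d j x| ^ p ≤ ∑ i, |d i x| ^ p :=
      Finset.single_le_sum (f := fun i => |d i x| ^ p)
        (fun i _ => Real.rpow_nonneg (abs_nonneg _) _) (Finset.mem_univ j)
    have h3 : ∑ i, (B i x - A i x) * d i x = (∑ i, B i x * d i x) - (∑ i, f i x * d i x)
        + ∑ i, (f i x - A i x) * d i x := by
      rw [← Finset.sum_sub_distrib, ← Finset.sum_add_distrib]
      exact Finset.sum_congr rfl fun i _ => by ring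
    have h4 : ν / 2 * |d j x| ^ p ≤ (∑ i, B i x * d i x) - (∑ i, f i x * d i x)
        + C * ∑ i, |f i x - A i x| ^ (p / (p - 1)) := by
      have := mul_le_mul_of_nonneg_left h2 (half_pos hν).le
      linarith
    have h5 := mul_le_mul_of_nonneg_left h4 (hγ0 x)
    have e : ∀ g : ι → α → ℝ, ∑ i, g i x * (γ x * d i x) = γ x * ∑ i, g i x * d i x := fun g => by
      rw [Finset.mul_sum]
      exact Finset.sum_congr rfl fun i _ => by ring
    rw [e B, e f]
    linarith
  have hsub : Integrable (fun x => (∑ i, B i x * (γ x * d i x)) - ∑ i, f i x * (γ x * d i x)) μ :=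
    (prod_int hB).sub (prod_int hf)
  rw [integral_add hsub (Hint.const_mul C), integral_sub (prod_int hB) (prod_int hf), integral_const_mul, integral_const_mul] at key
  rw [div_mul_eq_mul_div, le_div_iff₀ hν]
  linarith

theorem IsObstacleSolution.integral_truncated_le {n : ℕ} {Ω : Set (E n)} (hΩ : IsOpen Ω)
    {p : ℝ} {a : Fin n → E n → E n → ℝ} {f : Fin n → E n → ℝ} {ψ : E n → EReal}
    {θ θs u : E n → ℝ} (hu : IsObstacleSolution Ω p a f ψ θ u)
    (hθs : ∀ᵐ x ∂(volume.restrict Ω), ψ x ≤ (θs x : EReal)) {d : Fin n → E n → ℝ}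
    (hw : IsSobolevZeroPair Ω (fun x => u x - θs x) d)
    (hd : ∀ i, MemLp (d i) (ENNReal.ofReal p) (volume.restrict Ω))
    {G : ℝ → ℝ} {L : ℝ} (hG : ContDiff ℝ ∞ G) (hL : ∀ s, |deriv G s| ≤ L)
    (hpos : ∀ s, 0 ≤ s → 0 ≤ G s ∧ G s ≤ s) (hneg : ∀ s, s ≤ 0 → s ≤ G s ∧ G s ≤ 0) :
    ∫ x in Ω, ∑ i, a i x (weakGradient Ω u x) * (deriv G (u x - θs x) * d i x) ≤
      ∫ x in Ω, ∑ i, f i x * (deriv G (u x - θs x) * d i x) := by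
  obtain ⟨⟨hus, huψ, huθ⟩, hmin⟩ := hu
  have hG0 : G 0 = 0 := le_antisymm (hneg 0 le_rfl).2 (hpos 0 le_rfl).1
  have hV := hw.comp hG hG0 hL
  have hVd : ∀ i, MemLp (fun x => deriv G (u x - θs x) * d i x) (ENNReal.ofReal p)
      (volume.restrict Ω) := fun i =>
    (hd i).of_le_mul (c := L) (hV.integrableOn_grad i).1 (Eventually.of_forall fun x => by
      rw [norm_mul]; exact mul_le_mul_of_nonneg_right (hL _) (norm_nonneg _))
  have hVs := hV.memSobolevZero hΩ hVd
  set v : E n → ℝ := fun x => u x - G (u x - θs x) with hv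
  have hvK : MemObstacleClass Ω p ψ θ v := by
    refine ⟨hus.sub hΩ ⟨hVs.1.1, hVs.2⟩, ?_, ?_⟩
    · filter_upwards [huψ, hθs] with x h1 h2
      -- Where u ≥ θ_*, G(s) ≤ s keeps v above θ_*; elsewhere G ≤ 0 keeps v above u.
      rcases le_total 0 (u x - θs x) with h | h
      · refine h2.trans (EReal.coe_le_coe_iff.2 ?_)
        have := (hpos _ h).2
        simp only [hv]
        linarith
      · refine h1.trans (EReal.coe_le_coe_iff.2 ?_)
        have := (hneg _ h).2
        simp only [hv]
        linarith
    · have h1 := huθ.1.isSobolevZeroPair.sub hV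
      have e : (fun x => v x - θ x) = fun x => (u x - θ x) - G (u x - θs x) := by
        funext x; simp only [hv]; ring
      rw [e]
      exact h1.memSobolevZero hΩ fun i => (huθ.2 i).sub (hVd i)
  have hDv : ∀ᵐ x ∂(volume.restrict Ω), ∀ i, weakPartial Ω i v x - weakPartial Ω i u x
      = -(deriv G (u x - θs x) * d i x) := by
    rw [ae_all_iff]
    intro i
    filter_upwards [(hus.1.isWeakPartial_sub hVs.1.1 i).weakPartial_ae_eq hΩ,
      hV.weakPartial_ae_eq hΩ i] with x h1 h2
    rw [hv, h1, h2]
    ring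
  have key := hmin v hvK
  have conv : ∀ g : Fin n → E n → ℝ,
      ∫ x in Ω, ∑ i, g i x * (weakPartial Ω i v x - weakPartial Ω i u x) =
        -∫ x in Ω, ∑ i, g i x * (deriv G (u x - θs x) * d i x) := by
    intro g
    rw [← integral_neg]
    refine integral_congr_ae ?_
    filter_upwards [hDv] with x hx
    rw [← Finset.sum_neg_distrib]
    exact Finset.sum_congr rfl fun i _ => by rw [hx i]; ring
  rw [conv f, conv fun i x => a i x (weakGradient Ω u x)] at key
  linarith

end Energy

end ObstacleProblem

/-! ### The main theorem. -/

theorem mainTheorem3 (n : ℕ) (hn : 2 ≤ n) (Ω : Set (ObstacleProblem.E n)) (hΩo : IsOpen Ω)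
    (hΩb : Bornology.IsBounded Ω) (p q : ℝ) (hp : 1 < p) (hpq : p < q) (hqn : q < n)
    (a : Fin n → ObstacleProblem.E n → ObstacleProblem.E n → ℝ)
    (ha : ∀ i, ObstacleProblem.IsCaratheodory Ω (a i))
    (h : ObstacleProblem.E n → ℝ)
    (hh_nonneg : ∀ᵐ x ∂(volume.restrict Ω), 0 ≤ h x)
    (hh : MemLp h (ENNReal.ofReal (q / p)) (volume.restrict Ω))
    (c₁ : ℝ)
    (hgrowth : ∀ᵐ x ∂(volume.restrict Ω), ∀ (z : ObstacleProblem.E n) (i : Fin n),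
      |a i x z| ≤ c₁ * (h x + ∑ j, |z j| ^ p) ^ (1 - 1 / p))
    (ν : ℝ) (hν : 0 < ν)
    (hmono : ∀ᵐ x ∂(volume.restrict Ω), ∀ z z' : ObstacleProblem.E n,
      ν * ∑ i, |z i - z' i| ^ p ≤ ∑ i, (a i x z - a i x z') * (z i - z' i))
    (f : Fin n → ObstacleProblem.E n → ℝ)
    (hf : ∀ i, MemLp (f i) (ENNReal.ofReal (q / (p - 1))) (volume.restrict Ω))
    (ψ : ObstacleProblem.E n → EReal) (θ θs : ObstacleProblem.E n → ℝ)
    (hθ : ObstacleProblem.MemSobolev Ω q θ)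
    (hθs : ∀ᵐ x ∂(volume.restrict Ω), ((θs x : ℝ) : EReal) = max (ψ x) (θ x : EReal))
    (hθs_mem : ObstacleProblem.MemSobolevZero Ω q (fun x => θs x - θ x))
    (u : ObstacleProblem.E n → ℝ)
    (hu : ObstacleProblem.IsObstacleSolution Ω p a f ψ θ u) :
    ObstacleProblem.MemWeakLp Ω (n * q / (n - q)) (fun x => u x - θs x) := by
  open ObstacleProblem in
  have hp0 : 0 < p := by linarith
  have hp1 : 0 < p - 1 := by linarith
  have hq0 : 0 < q := by linarith
  have hn1 : (1 : ℝ) < n := by exact_mod_cast hn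
  have hn1' : (0 : ℝ) < n - 1 := by linarith
  set μ : Measure (E n) := volume.restrict Ω with hμ
  have : IsFiniteMeasure μ := ⟨by
    rw [hμ, Measure.restrict_apply_univ]; exact hΩb.measure_lt_top⟩
  obtain ⟨⟨hus, huψ, huθ⟩, -⟩ := id hu
  -- The gradients of `θs` and of `u - θs`
  set Z : Fin n → E n → ℝ := fun i x =>
    weakPartial Ω i (fun x => θs x - θ x) x + weakPartial Ω i θ x with hZdef
  -- Writing u - θ_* as (u - θ) - (θ_* - θ), a difference of two functions of zero trace, shows that
  -- it has zero trace too.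
  set d : Fin n → E n → ℝ := fun i x =>
    weakPartial Ω i (fun x => u x - θ x) x - weakPartial Ω i (fun x => θs x - θ x) x with hddef
  have hZ : ∀ i, MemLp (Z i) (ENNReal.ofReal q) μ := fun i => (hθs_mem.2 i).add (hθ.2 i)
  have hpqE : ENNReal.ofReal p ≤ ENNReal.ofReal q := ENNReal.ofReal_le_ofReal hpq.le
  have hd : ∀ i, MemLp (d i) (ENNReal.ofReal p) μ := fun i =>
    (huθ.2 i).sub ((hθs_mem.2 i).mono_exponent hpqE)
  have hw : IsSobolevZeroPair Ω (fun x => u x - θs x) d := by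
    have := huθ.1.isSobolevZeroPair.sub hθs_mem.1.isSobolevZeroPair
    have e : (fun x => u x - θ x - (θs x - θ x)) = fun x => u x - θs x := by
      funext x; ring
    rwa [e] at this
  have hdZ : ∀ᵐ x ∂μ, ∀ i, weakPartial Ω i u x - Z i x = d i x := by
    rw [ae_all_iff]
    intro i
    filter_upwards [(hus.1.isWeakPartial_sub hθ.1 i).weakPartial_ae_eq hΩo] with x hx
    simp only [hZdef, hddef]
    rw [hx]
    ring
  -- Integrability of the coefficients
  set A : Fin n → E n → ℝ := fun i x => a i x (WithLp.toLp 2 fun i => Z i x) with hAdef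
  set B : Fin n → E n → ℝ := fun i x => a i x (weakGradient Ω u x) with hBdef
  have hgr : ∀ i, ∀ᵐ x ∂μ, ∀ z : E n,
      |a i x z| ≤ c₁ * (h x + ∑ j, |z j| ^ p) ^ (1 - 1 / p) := fun i => by
    filter_upwards [hgrowth] with x hx z using hx z i
  have hAq : ∀ i, MemLp (A i) (ENNReal.ofReal (q / (p - 1))) μ := fun i =>
    (ha i).memLp_comp hp hh_nonneg hh (hgr i) hZ
  have hB : ∀ i, MemLp (B i) (ENNReal.ofReal (p / (p - 1))) μ := fun i =>
    (ha i).memLp_comp hp hh_nonneg (hh.mono_exponent (ENNReal.ofReal_le_ofReal (by gcongr)))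
      (hgr i) hus.2
  have hle : ENNReal.ofReal (p / (p - 1)) ≤ ENNReal.ofReal (q / (p - 1)) :=
    ENNReal.ofReal_le_ofReal (by gcongr)
  set H : E n → ℝ := fun x => ∑ i, |f i x - A i x| ^ (p / (p - 1)) with hHdef
  have hH : MemLp H (ENNReal.ofReal (q / p)) μ := by
    refine memLp_finsetSum _ fun i _ => ?_
    have := memLp_abs_rpow (div_pos hp0 hp1) ((hf i).sub (hAq i))
    have e : q / (p - 1) / (p / (p - 1)) = q / p := by field_simp
    rwa [e] at this
  have hmono' : ∀ᵐ x ∂μ, ν * ∑ i, |d i x| ^ p ≤ ∑ i, (B i x - A i x) * d i x := by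
    filter_upwards [hmono, hdZ] with x hx hx2
    have := hx (weakGradient Ω u x) (WithLp.toLp 2 fun i => Z i x)
    simp only [weakGradient, hx2] at this
    exact this
  have hψθs : ∀ᵐ x ∂μ, ψ x ≤ (θs x : EReal) := by
    filter_upwards [hθs] with x hx
    rw [hx]
    exact le_max_left _ _
  obtain ⟨C, hC0, hC⟩ := exists_young_const hp (half_pos hν)
  obtain ⟨L, hL0, hGk⟩ := exists_smooth_tail_scaled
  obtain ⟨S, hS, hSob⟩ := exists_sobolev_const hn
  set N : ℝ≥0∞ := (ENNReal.ofReal (L ^ p * (2 * C / ν)) * eLpNorm H (ENNReal.ofReal (q / p)) μ)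
    ^ (1 / p) with hN
  have hNtop : N ≠ ⊤ := ENNReal.rpow_ne_top_of_nonneg (by positivity)
    (ENNReal.mul_ne_top ENNReal.ofReal_ne_top hH.2.ne)
  set α : ℝ := n / (n - 1) with hα
  have hα0 : 0 < α := by positivity
  have h1q : 0 ≤ 1 - 1 / q := by
    rw [sub_nonneg, div_le_one hq0]; linarith
  -- Decay of the superlevel sets
  have decay : ∀ k : ℝ, 0 < k → ENNReal.ofReal k ^ α * μ {x | 2 * k < |u x - θs x|} ≤
      (S * (n * N)) ^ α * μ {x | k < |u x - θs x|} ^ ((1 - 1 / q) * α) := by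
    intro k hk
    obtain ⟨G, hG, hG1, hG2, hG3, hG4, hG5, hG6⟩ := hGk k hk
    have hGL : ∀ s, |deriv G s| ≤ L := fun s => by rw [abs_of_nonneg (hG1 s)]; exact hG2 s
    have hG0 : G 0 = 0 := le_antisymm (hG5 0 le_rfl).2 (hG4 0 le_rfl).1
    have hV := hw.comp hG hG0 hGL
    have hγm : AEStronglyMeasurable (fun x => deriv G (u x - θs x)) μ :=
      (hG.continuous_deriv (by simp)).comp_aestronglyMeasurable hw.integrableOn.1
    have hsupp : Function.support (fun x => deriv G (u x - θs x)) ⊆ {x | k < |u x - θs x|} := by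
      intro x hx
      by_contra hx'
      exact hx (hG3 _ (not_lt.1 hx'))
    have htest := hu.integral_truncated_le hΩo hψθs hw hd hG hGL hG4 hG5
    have hen := integral_weighted_rpow_le hp hν hC hγm (fun x => hG1 _) (fun x => hG2 _) hd
      (fun i => (hf i).mono_exponent hle) (fun i => (hAq i).mono_exponent hle) hB hmono' htest
    have hgrad : ∀ i, eLpNorm (fun x => deriv G (u x - θs x) * d i x) 1 μ ≤
        N * μ {x | k < |u x - θs x|} ^ (1 - 1 / q) := fun i =>
      eLpNorm_weighted_le hp hpq hL0 (by positivity) hγm (fun x => hG1 _) (fun x => hG2 _) hsupp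
        (hd i) hH (hen i)
    have hsob : eLpNorm (fun x => G (u x - θs x)) (ENNReal.ofReal α) μ ≤
        S * (n * N) * μ {x | k < |u x - θs x|} ^ (1 - 1 / q) := by
      refine (hSob Ω _ _ hΩo hV).trans ?_
      rw [mul_assoc, mul_assoc]
      gcongr
      refine (Finset.sum_le_sum fun i _ => hgrad i).trans (le_of_eq ?_)
      simp
    -- Chebyshev at level k is enough: where |w| > 2k, |G(w)| = |w| > k.
    have hcheb := mul_meas_ge_le_pow_eLpNorm' μ (p := ENNReal.ofReal α) (by simpa using hα0)
      ENNReal.ofReal_ne_top hV.integrableOn.1 (ENNReal.ofReal k)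
    rw [ENNReal.toReal_ofReal hα0.le] at hcheb
    calc ENNReal.ofReal k ^ α * μ {x | 2 * k < |u x - θs x|}
        ≤ ENNReal.ofReal k ^ α * μ {x | ENNReal.ofReal k ≤ ‖G (u x - θs x)‖ₑ} := by
          refine mul_le_mul_right (measure_mono fun x (hx : 2 * k < |u x - θs x|) => ?_) _
          change _ ≤ ‖G (u x - θs x)‖ₑ
          rw [hG6 _ hx.le, ← ofReal_norm]
          refine ENNReal.ofReal_le_ofReal ?_
          rw [Real.norm_eq_abs]
          linarith
      _ ≤ _ := hcheb
      _ ≤ (S * (n * N) * μ {x | k < |u x - θs x|} ^ (1 - 1 / q)) ^ α :=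
          ENNReal.rpow_le_rpow hsob hα0.le
      _ = _ := by
          rw [ENNReal.mul_rpow_of_nonneg _ _ hα0.le, ← ENNReal.rpow_mul]
  have hSN : (S * (n * N)) ^ α ≠ ⊤ := ENNReal.rpow_ne_top_of_nonneg hα0.le
    (ENNReal.mul_ne_top hS (ENNReal.mul_ne_top (ENNReal.natCast_ne_top n) hNtop))
  have hβ0 : 0 ≤ (1 - 1 / q) * α := mul_nonneg h1q hα0.le
  -- The hypothesis q < n enters here, making 1 - β positive.
  have hβ1 : 1 - (1 - 1 / q) * α = (n - q) / ((n - 1) * q) := by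
    rw [hα]; field_simp; ring
  have hβ : (1 - 1 / q) * α < 1 := by
    have : 0 < (n - q) / ((n - 1) * q) := div_pos (by linarith) (by positivity)
    linarith
  obtain ⟨K, hK0, hK⟩ := exists_rpow_decay_of_doubling
    (m := fun k => μ.real {x | k < |u x - θs x|}) (C := ((S * (n * N)) ^ α).toReal)
    (M := μ.real Set.univ) ENNReal.toReal_nonneg hβ0 hβ hα0 (fun k => measureReal_nonneg)
    (fun k => measureReal_mono (Set.subset_univ _))
    (fun k l hkl => measureReal_mono fun x (hx : l < _) => lt_of_le_of_lt hkl hx) (by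
      intro k hk
      have h1 := ENNReal.toReal_mono (ENNReal.mul_ne_top hSN
        (ENNReal.rpow_ne_top_of_nonneg hβ0 (measure_ne_top μ _))) (decay k hk)
      rw [ENNReal.toReal_mul, ENNReal.toReal_mul, ← ENNReal.toReal_rpow, ← ENNReal.toReal_rpow _ (_ * α),
        ENNReal.toReal_ofReal hk.le] at h1
      have hkα : 0 < k ^ α := Real.rpow_pos_of_pos hk _
      rw [Real.rpow_neg hk.le]
      change (μ _).toReal ≤ _ * _ * (μ _).toReal ^ _
      rw [mul_right_comm, ← div_eq_mul_inv, le_div_iff₀ hkα, mul_comm]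
      exact h1)
  refine ⟨hw.integrableOn.1, K, hK0, fun τ hτ => ?_⟩
  have e : α / (1 - (1 - 1 / q) * α) = n * q / (n - q) := by
    have : (n : ℝ) - q ≠ 0 := by linarith
    rw [hβ1, hα]
    field_simp
  have hs : volume {x ∈ Ω | τ < |u x - θs x|} = μ {x | τ < |u x - θs x|} := by
    rw [hμ, Measure.restrict_apply' hΩo.measurableSet]
    congr 1
    ext x
    simp [and_comm]
  rw [hs, ← e, ← ENNReal.ofReal_toReal (measure_ne_top μ _)]
  exact ENNReal.ofReal_le_ofReal (hK τ hτ)
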